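/- Let $A\in M_n(\mathbb{R})$ and consider the linear time-invariant system $\dot x=Ax$ on $\mathbb{R}^n$; for $t\ge 0$ let $\varphi(t,x_0)$ denote its solution at time $t$ with initial condition $x(0)=x_0$. Let $K\subset\mathbb{R}^n$ be a compact set of positive Lebesgue measure (for instance a closed cube). For $T,\varepsilon>0$, a finite set $S\subset K$ is called $(T,\varepsilon)$-spanning if for every $x_0\in K$ there is $x\in S$ with $\|\varphi(t,x_0)-\varphi(t,x)\|_\infty<\varepsilon$ for all $t\in[0,T]$; let $s(T,\varepsilon)$ be the minimal cardinality of a $(T,\varepsilon)$-spanning set. Then the topological entropy $$h(A):=\lim_{\varepsilon\to 0^+}\ \limsup_{T\to\infty}\frac{\log s(T,\varepsilon)}{T}$$ exists and equals $$h(A)=\sum_{\lambda}\max\{0,\operatorname{Re}\lambda\},$$ where the sum is over the complex eigenvalues $\lambda$ of $A$, counted with algebraic multiplicity, and $\log$ is the natural logarithm. -/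

import Mathlib

open Filter Topology MeasureTheory

noncomputable section

/-- `φ t x₀` is, for `t ≥ 0`, the value at time `t` of a solution of `x' = f (t, x)`, `x 0 = x₀`
(one-sided derivative at `t = 0`). -/
def IsSolutionMap {E : Type*} [NormedAddCommGroup E] [NormedSpace ℝ E]
    (f : ℝ → E → E) (φ : ℝ → E → E) : Prop :=
  ∀ x₀ : E, φ 0 x₀ = x₀ ∧
    ∀ t : ℝ, 0 ≤ t →
      HasDerivWithinAt (fun s => φ s x₀) (f t (φ t x₀)) (Set.Ici 0) t

/-- The finite set `S` of initial conditions is `(T, ε)`-spanning for the initial set `K`. -/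
def IsSpanning {E : Type*} [NormedAddCommGroup E]
    (φ : ℝ → E → E) (K : Set E) (T ε : ℝ) (S : Finset E) : Prop :=
  (S : Set E) ⊆ K ∧
    ∀ x₀ ∈ K, ∃ x ∈ S, ∀ t ∈ Set.Icc 0 T, ‖φ t x₀ - φ t x‖ < ε

/-- The minimal cardinality `s(T, ε)` of a `(T, ε)`-spanning set (`⊤` if there is none). -/
def spanningCard {E : Type*} [NormedAddCommGroup E]
    (φ : ℝ → E → E) (K : Set E) (T ε : ℝ) : ℕ∞ :=
  ⨅ (S : Finset E) (_ : IsSpanning φ K T ε S), (S.card : ℕ∞)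

/-- `limsup_{T → ∞} log s(T, ε) / T`, as an extended real number. -/
def entropyAtScale {E : Type*} [NormedAddCommGroup E]
    (φ : ℝ → E → E) (K : Set E) (ε : ℝ) : EReal :=
  limsup (fun T : ℝ => ENNReal.log ((spanningCard φ K T ε : ℕ∞) : ENNReal) / (T : EReal)) atTop

/-- The limit `lim_{ε → 0⁺} limsup_{T → ∞} log s(T, ε) / T` defining the topological entropy
(with initial set `K`) exists and equals `h`. -/
def HasTopologicalEntropy {E : Type*} [NormedAddCommGroup E]
    (φ : ℝ → E → E) (K : Set E) (h : EReal) : Prop :=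
  Tendsto (fun ε : ℝ => entropyAtScale φ K ε) (𝓝[>] 0) (𝓝 h)

/-- `∑ max {0, Re λ}` over the complex eigenvalues of the real matrix `A`, counted with algebraic
multiplicity. -/
def unstableEigenvalueSum {n : ℕ} (A : Matrix (Fin n) (Fin n) ℝ) : ℝ :=
  ((A.map (algebraMap ℝ ℂ)).charpoly.roots.map fun z : ℂ => max 0 z.re).sum

end

/-! By linearity, the points that stay within `ε` of `x` up to time `T` form a translate of one
dynamical ball, so spanning sets are counted by volume. Covering `K` gives the lower bound
(`volume_le_card_mul_of_isSpanning`). A maximal separated set is spanning, and packing disjoint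
balls around it gives the upper bound (`card_mul_volume_le_of_separated`). It remains to show that
the ball has volume `exp (-h T)` up to subexponential factors, `h` being the eigenvalue sum.

Instead of a real Jordan form, the proof identifies pairs `(x, y)` with `x + i y`. In a generalized
eigenbasis the product of the ball with itself lies between polydiscs whose radii are about `exp
(-max 0 (Re λ) T)`. A complex disc of radius `r` has area `π r ^ 2`, so the measure of a polydisc is
a square, and its root is the volume of one ball. The nilpotent parts contribute only polynomial
factors, absorbed into `exp (δ t)` with `δ` arbitrarily small (`exists_coordinates`). -/

/-! ### Growth rates in a generalized eigenbasis -/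

/-- A basis of generalized eigenvectors of `f`, labelled by the eigenvalues; the labels are the
roots of the characteristic polynomial with multiplicity. -/
theorem exists_basis_maxGenEigenspace {V : Type*} [AddCommGroup V] [Module ℂ V]
    [FiniteDimensional ℂ V] (f : Module.End ℂ V) :
    ∃ (ι : Type) (_ : Fintype ι) (b : Module.Basis ι ℂ V) (ev : ι → ℂ),
      f.charpoly.roots = Finset.univ.val.map ev ∧
      (∀ j, b j ∈ f.maxGenEigenspace (ev j)) ∧
      ∀ i j, ev i ≠ ev j → ∀ v ∈ f.maxGenEigenspace (ev j), b.repr v i = 0 := by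
  classical
  have hint : DirectSum.IsInternal f.maxGenEigenspace :=
    DirectSum.isInternal_submodule_of_iSupIndep_of_iSup_eq_top
      f.independent_maxGenEigenspace f.iSup_maxGenEigenspace_eq_top
  let b := hint.collectedBasis fun μ => Module.finBasis ℂ (f.maxGenEigenspace μ)
  have : Fintype (Σ μ : ℂ, Fin (Module.finrank ℂ (f.maxGenEigenspace μ))) :=
    FiniteDimensional.fintypeBasisIndex b
  refine ⟨_, this, b, Sigma.fst, ?_, fun j => hint.collectedBasis_mem _ j, ?_⟩
  · ext μ
    rw [Polynomial.count_roots, ← f.finrank_maxGenEigenspace_eq μ, Multiset.count_map,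
      ← Finset.filter_val, Finset.card_val, ← Fintype.card_subtype]
    rw [← Fintype.card_fin (Module.finrank ℂ (f.maxGenEigenspace μ))]
    refine Fintype.card_congr ⟨fun k => ⟨⟨μ, k⟩, rfl⟩, fun p => p.2 ▸ p.1.2, fun k => rfl, ?_⟩
    rintro ⟨⟨ν, k⟩, h⟩
    cases h
    rfl
  · rintro ⟨μ, a⟩ ⟨ν, c⟩ hij v hv
    exact hint.collectedBasis_repr_of_mem_ne _ (Ne.symm hij) hv

/-- On a generalized eigenvector the exponential series of `L - μ` terminates. -/
theorem exp_apply_of_pow_apply_eq_zero {E : Type*} [NormedAddCommGroup E] [NormedSpace ℂ E]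
    [CompleteSpace E] (L : E →L[ℂ] E) (μ : ℂ) (v : E) (k : ℕ)
    (hv : ((L - algebraMap ℂ (E →L[ℂ] E) μ) ^ k) v = 0) (t : ℂ) :
    NormedSpace.exp (t • L) v = Complex.exp (t * μ) •
      ∑ m ∈ Finset.range k, (t ^ m / (m.factorial : ℂ)) •
        ((L - algebraMap ℂ (E →L[ℂ] E) μ) ^ m) v := by
  set N := L - algebraMap ℂ (E →L[ℂ] E) μ with hN
  have : NormedAlgebra ℚ (E →L[ℂ] E) := NormedAlgebra.restrictScalars ℚ ℂ _
  have hsplit : t • L = algebraMap ℂ (E →L[ℂ] E) (t * μ) + t • N := by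
    rw [hN, smul_sub, Algebra.algebraMap_eq_smul_one, Algebra.algebraMap_eq_smul_one, smul_smul]
    abel
  have hcomm : Commute (algebraMap ℂ (E →L[ℂ] E) (t * μ)) (t • N) := Algebra.commutes _ _
  rw [hsplit, NormedSpace.exp_add_of_commute hcomm, ← NormedSpace.algebraMap_exp_comm,
    ← Complex.exp_eq_exp_ℂ, Algebra.algebraMap_eq_smul_one, smul_mul_assoc, one_mul,
    smul_apply]
  congr 1
  have hs := (NormedSpace.exp_series_hasSum_exp' (𝕂 := ℂ) (t • N)).mapL
    (ContinuousLinearMap.apply ℂ E v)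
  refine hs.unique ?_
  have h0 : ∀ m ∉ Finset.range k, ContinuousLinearMap.apply ℂ E v
      (((m.factorial : ℂ)⁻¹) • (t • N) ^ m) = 0 := by
    intro m hm
    obtain ⟨d, rfl⟩ := Nat.exists_eq_add_of_le (not_lt.mp (mt Finset.mem_range.mpr hm))
    have : (N ^ (k + d)) v = 0 := by
      rw [add_comm, pow_add, mul_apply_eq_comp, hv, map_zero]
    simp [smul_pow, this]
  convert hasSum_sum_of_ne_finset_zero (L := .unconditional ℕ) h0 using 1
  refine Finset.sum_congr rfl fun m _ => ?_
  simp [smul_pow, smul_smul, div_eq_inv_mul]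

/-- Growth of the flow in coordinates of a generalized eigenbasis. -/
theorem exists_norm_repr_exp_le {E ι : Type*} [NormedAddCommGroup E] [NormedSpace ℂ E]
    [FiniteDimensional ℂ E] [Fintype ι] (L : E →L[ℂ] E) (b : Module.Basis ι ℂ E) (ev : ι → ℂ)
    (hb : ∀ j, b j ∈ Module.End.maxGenEigenspace (L : Module.End ℂ E) (ev j))
    (hrepr : ∀ i j, ev i ≠ ev j →
      ∀ v ∈ Module.End.maxGenEigenspace (L : Module.End ℂ E) (ev j), b.repr v i = 0)
    {δ : ℝ} (hδ : 0 < δ) :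
    ∃ C : ℝ, 0 < C ∧ ∀ (t : ℝ) (d : ι → ℝ), (∀ i j, ev i = ev j → d i = d j) →
      ∀ z : E, (∀ i, ‖b.repr z i‖ ≤ d i) → ∀ i,
        ‖b.repr (NormedSpace.exp ((t : ℂ) • L) z) i‖ ≤
          C * Real.exp ((ev i).re * t + δ * |t|) * d i := by
  classical
  have : CompleteSpace E := FiniteDimensional.complete ℂ E
  let N : ι → E →L[ℂ] E := fun j => L - algebraMap ℂ (E →L[ℂ] E) (ev j)
  have hN : ∀ j m v, ((N j) ^ m) v =
      (((L : Module.End ℂ E) - algebraMap ℂ (Module.End ℂ E) (ev j)) ^ m) v := by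
    intro j m
    induction m with
    | zero => intro v; simp
    | succ m ih =>
      intro v
      rw [pow_succ, pow_succ, mul_apply_eq_comp, ih, Module.End.mul_apply]
      rfl
  have hk : ∀ j, ∃ k : ℕ, ((N j) ^ k) (b j) = 0 := by
    intro j
    obtain ⟨k, hk⟩ := (Module.End.mem_maxGenEigenspace _ _ _).1 (hb j)
    exact ⟨k, by rw [hN]; exact hk⟩
  choose k hk using hk
  have hmem : ∀ j m, ((N j) ^ m) (b j) ∈
      Module.End.maxGenEigenspace (L : Module.End ℂ E) (ev j) := by
    intro j m
    rw [hN]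
    refine Module.End.mapsTo_maxGenEigenspace_of_comm ?_ (ev j) (hb j)
    exact ((Commute.refl _).sub_right (Algebra.commute_algebraMap_right _ _)).pow_right m
  -- The weights come from `|t| ^ m / m! ≤ δ⁻ᵐ exp (δ |t|)`, which trades the polynomial factor for
  -- a small exponential.
  let c : ι → ι → ℝ := fun i j =>
    ∑ m ∈ Finset.range (k j), (δ ^ m)⁻¹ * ‖b.repr (((N j) ^ m) (b j)) i‖
  have hc : ∀ i j, 0 ≤ c i j := fun i j => Finset.sum_nonneg fun m _ => by positivity
  have hentry : ∀ (t : ℝ) i j, ‖b.repr (NormedSpace.exp ((t : ℂ) • L) (b j)) i‖ ≤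
      c i j * Real.exp ((ev j).re * t + δ * |t|) := by
    intro t i j
    rw [exp_apply_of_pow_apply_eq_zero L (ev j) (b j) (k j) (hk j)]
    rw [map_smul, map_sum, Finsupp.smul_apply, Finsupp.finsetSum_apply, norm_smul,
      Complex.norm_exp, Real.exp_add]
    have h1 : ((t : ℂ) * ev j).re = (ev j).re * t := by simp [mul_comm]
    rw [h1, mul_comm (c i j), mul_assoc]
    refine mul_le_mul_of_nonneg_left ?_ (Real.exp_pos _).le
    refine (norm_sum_le _ _).trans ?_
    rw [Finset.mul_sum]
    refine Finset.sum_le_sum fun m _ => ?_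
    rw [map_smul, Finsupp.smul_apply, norm_smul, ← mul_assoc]
    refine mul_le_mul_of_nonneg_right ?_ (norm_nonneg _)
    have h2 := Real.pow_div_factorial_le_exp (δ * |t|) (by positivity) m
    have h3 : ‖(t : ℂ) ^ m / (m.factorial : ℂ)‖ = |t| ^ m / m.factorial := by simp
    rw [h3, ← div_eq_mul_inv, le_div_iff₀ (by positivity)]
    calc |t| ^ m / m.factorial * δ ^ m = (δ * |t|) ^ m / m.factorial := by rw [mul_pow]; ring
      _ ≤ _ := h2
  have hzero : ∀ (t : ℝ) i j, ev i ≠ ev j →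
      b.repr (NormedSpace.exp ((t : ℂ) • L) (b j)) i = 0 := by
    intro t i j hij
    rw [exp_apply_of_pow_apply_eq_zero L (ev j) (b j) (k j) (hk j)]
    refine hrepr i j hij _ (Submodule.smul_mem _ _ (Submodule.sum_mem _ fun m _ =>
      Submodule.smul_mem _ _ (hmem j m)))
  -- The summand `1` keeps the constant positive even for an empty basis.
  refine ⟨1 + ∑ i, ∑ j, c i j,
    by have := Finset.sum_nonneg fun i (_ : i ∈ Finset.univ) =>
        Finset.sum_nonneg fun j (_ : j ∈ Finset.univ) => hc i j
       linarith, ?_⟩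
  intro t d hd z hz i
  have hdi : 0 ≤ d i := (norm_nonneg _).trans (hz i)
  have hexp : b.repr (NormedSpace.exp ((t : ℂ) • L) z) i =
      ∑ j, b.repr z j * b.repr (NormedSpace.exp ((t : ℂ) • L) (b j)) i := by
    conv_lhs => rw [← b.sum_repr z]
    simp only [map_sum, map_smul, Finsupp.finsetSum_apply, Finsupp.smul_apply, smul_eq_mul]
  rw [hexp]
  have hterm : ∀ j, ‖b.repr z j * b.repr (NormedSpace.exp ((t : ℂ) • L) (b j)) i‖ ≤
      c i j * (Real.exp ((ev i).re * t + δ * |t|) * d i) := by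
    intro j
    -- Only coordinates with the same eigenvalue interact, and on those `d` is constant; hence the
    -- bound involves `d i` alone.
    by_cases hij : ev i = ev j
    · rw [norm_mul, hd i j hij, hij]
      calc _ ≤ d j * (c i j * Real.exp ((ev j).re * t + δ * |t|)) :=
            mul_le_mul (hz j) (hentry t i j) (norm_nonneg _) ((norm_nonneg _).trans (hz j))
        _ = _ := by ring
    · rw [hzero t i j hij, mul_zero, norm_zero]
      have := hc i j
      positivity
  refine (norm_sum_le _ _).trans ((Finset.sum_le_sum fun j _ => hterm j).trans ?_)
  rw [← Finset.sum_mul, mul_assoc]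
  refine mul_le_mul_of_nonneg_right ?_ (by positivity)
  have := Finset.single_le_sum (f := fun i => ∑ j, c i j)
    (fun i _ => Finset.sum_nonneg fun j _ => hc i j) (Finset.mem_univ i)
  linarith

/-! ### The complexified flow -/

/-- Solutions of the linear equation `z' = L z` on `[0, ∞)` are given by the exponential. -/
theorem eq_exp_smul_apply_of_hasDerivWithinAt {E : Type*} [NormedAddCommGroup E]
    [NormedSpace ℂ E] [CompleteSpace E] (L : E →L[ℂ] E) (z : ℝ → E)
    (hz : ∀ t, 0 ≤ t → HasDerivWithinAt z (L (z t)) (Set.Ici 0) t) {t : ℝ} (ht : 0 ≤ t) :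
    z t = NormedSpace.exp ((t : ℂ) • L) (z 0) := by
  let w : ℝ → E := fun s => NormedSpace.exp ((s : ℂ) • L) (z 0)
  have hw : ∀ s, HasDerivAt w (L (w s)) s := by
    intro s
    have h1 : HasDerivAt (fun u : ℂ => NormedSpace.exp (u • L) (z 0))
        ((L * NormedSpace.exp ((s : ℂ) • L)) (z 0)) (s : ℂ) :=
      ((ContinuousLinearMap.apply ℂ E (z 0)).hasFDerivAt).comp_hasDerivAt _
        (hasDerivAt_exp_smul_const' (𝕂 := ℂ) L (s : ℂ))
    simpa using! h1.scomp s (Complex.ofRealCLM.hasDerivAt (x := s))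
  refine ODE_solution_unique_of_mem_Icc_right (v := fun _ => L) (s := fun _ => Set.univ)
    (K := ‖L‖₊) (a := 0) (b := t) (f := z) (g := w) (fun _ _ => L.lipschitz.lipschitzOnWith)
    (fun s hs => ((hz s hs.1).continuousWithinAt).mono Set.Icc_subset_Ici_self)
    (fun s hs => (hz s hs.1).mono (Set.Ici_subset_Ici.2 hs.1)) (fun _ _ => trivial)
    (fun s _ => (hw s).continuousAt.continuousWithinAt) (fun s _ => (hw s).hasDerivWithinAt)
    (fun _ _ => trivial) ?_ ⟨ht, le_rfl⟩
  simp [w]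

theorem exp_neg_smul_apply_exp_smul_apply {E : Type*} [NormedAddCommGroup E]
    [NormedSpace ℂ E] [CompleteSpace E] (L : E →L[ℂ] E) (t : ℂ) (v : E) :
    NormedSpace.exp (-t • L) (NormedSpace.exp (t • L) v) = v := by
  have : NormedAlgebra ℚ (E →L[ℂ] E) := NormedAlgebra.restrictScalars ℚ ℂ _
  rw [← mul_apply_eq_comp, ← NormedSpace.exp_add_of_commute, ← add_smul, neg_add_cancel,
    zero_smul, NormedSpace.exp_zero]
  · rfl
  · exact ((Commute.refl L).smul_left _).smul_right _

/-- `(x, y) ↦ x + i y`, as a real linear isomorphism. -/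
noncomputable def realProdEquivComplex (n : ℕ) :
    ((Fin n → ℝ) × (Fin n → ℝ)) ≃L[ℝ] (Fin n → ℂ) :=
  LinearEquiv.toContinuousLinearEquiv
    { toFun := fun p i => ⟨p.1 i, p.2 i⟩
      invFun := fun z => (fun i => (z i).re, fun i => (z i).im)
      map_add' := fun _ _ => rfl
      map_smul' := fun c p => by
        ext i
        apply Complex.ext <;> simp
      left_inv := fun _ => rfl
      right_inv := fun _ => rfl }

theorem realProdEquivComplex_apply (n : ℕ) (p : (Fin n → ℝ) × (Fin n → ℝ)) (i : Fin n) :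
    realProdEquivComplex n p i = ⟨p.1 i, p.2 i⟩ := rfl

/-- The complexified flow is the matrix exponential. -/
theorem realProdEquivComplex_flow {n : ℕ} {A : Matrix (Fin n) (Fin n) ℝ}
    {φ : ℝ → (Fin n → ℝ) → (Fin n → ℝ)} (hφ : IsSolutionMap (fun _ x => A.mulVec x) φ)
    {t : ℝ} (ht : 0 ≤ t) (x y : Fin n → ℝ) :
    realProdEquivComplex n (φ t x, φ t y) = NormedSpace.exp ((t : ℂ) •
      LinearMap.toContinuousLinearMap (A.map (algebraMap ℝ ℂ)).mulVecLin)
        (realProdEquivComplex n (x, y)) := by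
  have key := eq_exp_smul_apply_of_hasDerivWithinAt
    (LinearMap.toContinuousLinearMap (A.map (algebraMap ℝ ℂ)).mulVecLin)
    (fun s => realProdEquivComplex n (φ s x, φ s y)) ?_ ht
  · simpa only [(hφ x).1, (hφ y).1] using key
  · intro s hs
    have h1 := ((hφ x).2 s hs).prodMk ((hφ y).2 s hs)
    have h2 := ((realProdEquivComplex n).hasFDerivAt).comp_hasDerivWithinAt s h1
    refine h2.congr_deriv ?_
    ext i
    change realProdEquivComplex n (A.mulVec (φ s x), A.mulVec (φ s y)) i =
      ((A.map (algebraMap ℝ ℂ)).mulVec (realProdEquivComplex n (φ s x, φ s y))) i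
    rw [realProdEquivComplex_apply]
    apply Complex.ext <;>
      simp [Matrix.mulVec, dotProduct, realProdEquivComplex_apply, Complex.re_sum, Complex.im_sum]

/-- In suitable complex coordinates on pairs of real vectors, the coordinate of index `i` grows,
up to an arbitrarily small exponential error, at the rate `Re (ev i)`. -/
theorem exists_coordinates {n : ℕ} {A : Matrix (Fin n) (Fin n) ℝ}
    {φ : ℝ → (Fin n → ℝ) → (Fin n → ℝ)} (hφ : IsSolutionMap (fun _ x => A.mulVec x) φ) :
    ∃ (ι : Type) (_ : Fintype ι) (ev : ι → ℂ)
      (c : ((Fin n → ℝ) × (Fin n → ℝ)) ≃L[ℝ] (ι → ℂ)),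
      unstableEigenvalueSum A = ∑ i, max 0 (ev i).re ∧
      ∀ δ > (0 : ℝ), ∃ C > (0 : ℝ), ∀ t ≥ (0 : ℝ), ∀ d : ι → ℝ,
        (∀ i j, ev i = ev j → d i = d j) → ∀ x y : Fin n → ℝ,
        ((∀ i, ‖c (x, y) i‖ ≤ d i) →
          ∀ i, ‖c (φ t x, φ t y) i‖ ≤ C * Real.exp ((ev i).re * t + δ * t) * d i) ∧
        ((∀ i, ‖c (φ t x, φ t y) i‖ ≤ d i) →
          ∀ i, ‖c (x, y) i‖ ≤ C * Real.exp (-(ev i).re * t + δ * t) * d i) := by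
  set L := LinearMap.toContinuousLinearMap (A.map (algebraMap ℝ ℂ)).mulVecLin with hL
  obtain ⟨ι, hι, b, ev, hroots, hb, hrepr⟩ :=
    exists_basis_maxGenEigenspace (A.map (algebraMap ℝ ℂ)).mulVecLin
  let c : ((Fin n → ℝ) × (Fin n → ℝ)) ≃L[ℝ] (ι → ℂ) :=
    (realProdEquivComplex n).trans
      (b.equivFun.restrictScalars ℝ).toContinuousLinearEquiv
  have hc : ∀ p i, c p i = b.repr (realProdEquivComplex n p) i := fun p i => rfl
  refine ⟨ι, hι, ev, c, ?_, fun δ hδ => ?_⟩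
  · rw [unstableEigenvalueSum, ← Matrix.charpoly_mulVecLin, hroots, Multiset.map_map]
    rfl
  obtain ⟨C, hC, H⟩ := exists_norm_repr_exp_le L b ev hb hrepr hδ
  refine ⟨C, hC, fun t ht d hd x y => ⟨fun hx i => ?_, fun hx i => ?_⟩⟩
  · have := H t d hd (realProdEquivComplex n (x, y)) hx i
    rwa [abs_of_nonneg ht, ← realProdEquivComplex_flow hφ ht, ← hc] at this
  · have := H (-t) d hd (realProdEquivComplex n (φ t x, φ t y)) hx i
    have hinv : NormedSpace.exp (((-t : ℝ) : ℂ) • L)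
        (realProdEquivComplex n (φ t x, φ t y)) = realProdEquivComplex n (x, y) := by
      rw [realProdEquivComplex_flow hφ ht, ← hL, Complex.ofReal_neg]
      exact exp_neg_smul_apply_exp_smul_apply L t _
    rw [abs_neg, abs_of_nonneg ht, hinv, ← hc] at this
    simpa using this

/-- The time-`t` maps are continuous and linear. -/
theorem exists_clm_flow {n : ℕ} {A : Matrix (Fin n) (Fin n) ℝ}
    {φ : ℝ → (Fin n → ℝ) → (Fin n → ℝ)} (hφ : IsSolutionMap (fun _ x => A.mulVec x) φ)
    {t : ℝ} (ht : 0 ≤ t) : ∃ Ψ : (Fin n → ℝ) →L[ℝ] (Fin n → ℝ), ∀ x, φ t x = Ψ x := by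
  let J := realProdEquivComplex n
  let e := (NormedSpace.exp ((t : ℂ) •
      LinearMap.toContinuousLinearMap (A.map (algebraMap ℝ ℂ)).mulVecLin)).restrictScalars ℝ
  refine ⟨(ContinuousLinearMap.fst ℝ _ _).comp (J.symm.toContinuousLinearMap.comp (e.comp
    (J.toContinuousLinearMap.comp (ContinuousLinearMap.inl ℝ _ _)))), fun x => ?_⟩
  have h := congrArg J.symm (realProdEquivComplex_flow hφ ht x 0)
  rw [ContinuousLinearEquiv.symm_apply_apply] at h
  exact congrArg Prod.fst h

/-! ### Volumes of polydiscs and dynamical balls -/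

/-- A Haar measure of a polydisc in complex coordinates. -/
theorem exists_measure_polydisc {E ι : Type*} [Fintype ι] [NormedAddCommGroup E]
    [NormedSpace ℝ E] [MeasurableSpace E] [BorelSpace E]
    (μ : Measure E) [μ.IsAddHaarMeasure] (c : E ≃L[ℝ] (ι → ℂ)) :
    ∃ κ : ℝ, 0 < κ ∧ ∀ d : ι → ℝ, (∀ i, 0 ≤ d i) →
      μ {p | ∀ i, ‖c p i‖ ≤ d i} = ENNReal.ofReal (κ * ∏ i, d i) ^ 2 := by
  let ν := μ.map c
  have hν : ν.IsAddHaarMeasure := c.isAddHaarMeasure_map μ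
  have heq := Measure.isAddLeftInvariant_eq_smul ν (volume : Measure (ι → ℂ))
  set k := Measure.addHaarScalarFactor ν (volume : Measure (ι → ℂ))
  have hk : 0 < k := Measure.addHaarScalarFactor_pos_of_isAddHaarMeasure _ _
  -- The measure is `k ∏ π (d i) ^ 2`; the root puts it in the form of a square.
  refine ⟨√(k * Real.pi ^ Fintype.card ι), by positivity, fun d hd => ?_⟩
  have hset : {p | ∀ i, ‖c p i‖ ≤ d i} =
      c ⁻¹' (Set.univ.pi fun i => Metric.closedBall (0 : ℂ) (d i)) := by
    ext p
    simp
  have hmeas : MeasurableSet (Set.univ.pi fun i => Metric.closedBall (0 : ℂ) (d i)) :=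
    MeasurableSet.univ_pi fun i => Metric.isClosed_closedBall.measurableSet
  have hpi : (NNReal.pi : ENNReal) = ENNReal.ofReal Real.pi := by
    rw [← NNReal.coe_real_pi, ENNReal.ofReal_coe_nnreal]
  rw [hset, ← Measure.map_apply c.continuous.measurable hmeas]
  change ν _ = _
  rw [heq, Measure.smul_apply, volume_pi_pi]
  simp only [Complex.volume_closedBall]
  have hprod : 0 ≤ ∏ i, d i := Finset.prod_nonneg fun i _ => hd i
  rw [Finset.prod_mul_distrib, Finset.prod_pow, Finset.prod_const, Finset.card_univ, hpi,
    ← ENNReal.ofReal_prod_of_nonneg fun i _ => hd i, ← ENNReal.ofReal_pow hprod,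
    ← ENNReal.ofReal_pow Real.pi_pos.le, ← ENNReal.ofReal_mul (by positivity),
    ← ENNReal.ofReal_pow (by positivity), mul_pow, Real.sq_sqrt (by positivity),
    ENNReal.smul_def, smul_eq_mul, ← ENNReal.ofReal_coe_nnreal,
    ← ENNReal.ofReal_mul (by positivity)]
  congr 1
  ring

/-- The closed dynamical ball of radius `r` about the origin, for the time horizon `T`. -/
def dynamicalBall {E : Type*} [NormedAddCommGroup E] (φ : ℝ → E → E) (T r : ℝ) : Set E :=
  {x | ∀ t ∈ Set.Icc 0 T, ‖φ t x‖ ≤ r}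

theorem prod_const_mul_exp {ι : Type*} [Fintype ι] (C T : ℝ) (a : ι → ℝ) :
    ∏ i, C * Real.exp (-a i * T) = C ^ Fintype.card ι * Real.exp (-(∑ i, a i) * T) := by
  rw [Finset.prod_mul_distrib, Finset.prod_const, Finset.card_univ, ← Real.exp_sum,
    ← Finset.sum_mul, Finset.sum_neg_distrib]

/-- Times `0` and `T` suffice: the bound at `0` controls coordinates with `Re λ ≤ 0`, and flowing
the bound at `T` backwards controls the others. -/
theorem volume_dynamicalBall_le {n : ℕ} {A : Matrix (Fin n) (Fin n) ℝ}
    {φ : ℝ → (Fin n → ℝ) → (Fin n → ℝ)} (hφ : IsSolutionMap (fun _ x => A.mulVec x) φ)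
    {r a : ℝ} (hr : 0 < r) (ha : a < unstableEigenvalueSum A) :
    ∃ C > (0 : ℝ), ∀ T ≥ (0 : ℝ),
      volume (dynamicalBall φ T r) ≤ ENNReal.ofReal (C * Real.exp (-a * T)) := by
  obtain ⟨ι, _, ev, c, hsum, hgrow⟩ := exists_coordinates hφ
  have : ((volume : Measure (Fin n → ℝ)).prod (volume : Measure (Fin n → ℝ))).IsAddHaarMeasure :=
    Measure.prod.instIsAddHaarMeasure _ _
  obtain ⟨κ, hκ, hvol⟩ := exists_measure_polydisc
    ((volume : Measure (Fin n → ℝ)).prod (volume : Measure (Fin n → ℝ))) c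
  -- Each coordinate loses `δ` in the exponent, and the total loss `card ι * δ` stays within the
  -- gap; the `+ 1` covers `card ι = 0`.
  set δ := (unstableEigenvalueSum A - a) / (Fintype.card ι + 1) with hδdef
  have hδ : 0 < δ := div_pos (sub_pos.2 ha) (by positivity)
  obtain ⟨C, hC, H⟩ := hgrow δ hδ
  set R := ‖c.toContinuousLinearMap‖ * r + 1
  have hR : 0 < R := by positivity
  refine ⟨κ * ((C + 1) * R) ^ Fintype.card ι, by positivity, fun T hT => ?_⟩
  have hcb : ∀ p : (Fin n → ℝ) × (Fin n → ℝ), ‖p‖ ≤ r → ∀ i, ‖c p i‖ ≤ R := by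
    intro p hp i
    have h1 : ‖c p‖ ≤ ‖c.toContinuousLinearMap‖ * ‖p‖ :=
      c.toContinuousLinearMap.le_opNorm p
    have h2 := mul_le_mul_of_nonneg_left hp (norm_nonneg c.toContinuousLinearMap)
    have h3 := norm_le_pi_norm (c p) i
    linarith
  -- The factor `C + 1` dominates both `C`, needed for expanding coordinates, and `1`, needed for
  -- the others.
  let d : ι → ℝ := fun i => (C + 1) * R * Real.exp (-(max 0 (ev i).re - δ) * T)
  have hsub : dynamicalBall φ T r ×ˢ dynamicalBall φ T r ⊆ {p | ∀ i, ‖c p i‖ ≤ d i} := by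
    rintro ⟨x, y⟩ ⟨hx, hy⟩ i
    have h0 : ‖c (x, y) i‖ ≤ R := by
      have hx0 := hx 0 ⟨le_rfl, hT⟩
      have hy0 := hy 0 ⟨le_rfl, hT⟩
      rw [(hφ _).1] at hx0 hy0
      exact hcb _ (max_le hx0 hy0) i
    have h1 := (H T hT (fun _ => R) (fun _ _ _ => rfl) x y).2
      (hcb _ (max_le (hx T ⟨hT, le_rfl⟩) (hy T ⟨hT, le_rfl⟩))) i
    change _ ≤ (C + 1) * R * Real.exp (-(max 0 (ev i).re - δ) * T)
    rcases le_total (ev i).re 0 with hre | hre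
    · rw [max_eq_left hre]
      have h2 : 1 ≤ Real.exp (-(0 - δ) * T) := Real.one_le_exp (by
        have := mul_nonneg hδ.le hT
        linarith)
      have h3 : R ≤ (C + 1) * R := by nlinarith
      nlinarith
    · rw [max_eq_right hre]
      have h2 : -(ev i).re * T + δ * T = -((ev i).re - δ) * T := by ring
      rw [h2] at h1
      have h3 := mul_pos hR (Real.exp_pos (-((ev i).re - δ) * T))
      nlinarith
  have hsq : volume (dynamicalBall φ T r) ^ 2 ≤ ENNReal.ofReal (κ * ∏ i, d i) ^ 2 := by
    rw [← hvol d fun i => by positivity, sq, ← Measure.prod_prod]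
    exact measure_mono hsub
  refine ((ENNReal.pow_right_strictMono two_ne_zero).le_iff_le.1 hsq).trans
    (ENNReal.ofReal_le_ofReal ?_)
  rw [prod_const_mul_exp, ← mul_assoc]
  refine mul_le_mul_of_nonneg_left (Real.exp_le_exp.2 ?_) (by positivity)
  refine mul_le_mul_of_nonneg_right (neg_le_neg ?_) hT
  rw [Finset.sum_sub_distrib, ← hsum, Finset.sum_const, Finset.card_univ, nsmul_eq_mul]
  have h4 : (Fintype.card ι + 1) * δ = unstableEigenvalueSum A - a := by
    rw [hδdef]; field_simp
  linarith

/-- Radii shrunk by `exp (-(max 0 (Re λ) + δ) T)` offset the forward growth at every time in `[0,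
T]`, so the whole polydisc stays in the ball. -/
theorem le_volume_dynamicalBall {n : ℕ} {A : Matrix (Fin n) (Fin n) ℝ}
    {φ : ℝ → (Fin n → ℝ) → (Fin n → ℝ)} (hφ : IsSolutionMap (fun _ x => A.mulVec x) φ)
    {r a : ℝ} (hr : 0 < r) (ha : unstableEigenvalueSum A < a) :
    ∃ C > (0 : ℝ), ∀ T ≥ (0 : ℝ),
      ENNReal.ofReal (C * Real.exp (-a * T)) ≤ volume (dynamicalBall φ T r) := by
  obtain ⟨ι, _, ev, c, hsum, hgrow⟩ := exists_coordinates hφ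
  have : ((volume : Measure (Fin n → ℝ)).prod (volume : Measure (Fin n → ℝ))).IsAddHaarMeasure :=
    Measure.prod.instIsAddHaarMeasure _ _
  obtain ⟨κ, hκ, hvol⟩ := exists_measure_polydisc
    ((volume : Measure (Fin n → ℝ)).prod (volume : Measure (Fin n → ℝ))) c
  set δ := (a - unstableEigenvalueSum A) / (Fintype.card ι + 1) with hδdef
  have hδ : 0 < δ := div_pos (sub_pos.2 ha) (by positivity)
  obtain ⟨C, hC, H⟩ := hgrow δ hδ
  set N := ‖c.symm.toContinuousLinearMap‖ with hN
  have hN0 : 0 ≤ N := norm_nonneg _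
  -- Chosen so that `C * ρ`, the bound on the evolved coordinates, becomes at most `r` after
  -- applying `c.symm`.
  set ρ := r / (C * (N + 1)) with hρdef
  have hρ : 0 < ρ := by positivity
  refine ⟨κ * ρ ^ Fintype.card ι, by positivity, fun T hT => ?_⟩
  let d : ι → ℝ := fun i => ρ * Real.exp (-(max 0 (ev i).re + δ) * T)
  have hsub : {p | ∀ i, ‖c p i‖ ≤ d i} ⊆ dynamicalBall φ T r ×ˢ dynamicalBall φ T r := by
    rintro ⟨x, y⟩ hp
    have key : ∀ t ∈ Set.Icc 0 T, ‖(φ t x, φ t y)‖ ≤ r := by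
      intro t ht
      have h1 : ∀ i, ‖c (φ t x, φ t y) i‖ ≤ C * ρ := by
        intro i
        refine ((H t ht.1 d (fun i j hij => by simp only [d, hij]) x y).1 hp i).trans ?_
        change C * _ * (ρ * _) ≤ _
        have h2 : Real.exp ((ev i).re * t + δ * t) * Real.exp (-(max 0 (ev i).re + δ) * T) ≤ 1 := by
          rw [← Real.exp_add, Real.exp_le_one_iff]
          have h3 := mul_le_mul_of_nonneg_right (le_max_right 0 (ev i).re) ht.1
          have h4 := mul_le_mul_of_nonneg_left ht.2
            (add_nonneg (le_max_left 0 (ev i).re) hδ.le)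
          linarith
        calc _ = C * ρ * (Real.exp ((ev i).re * t + δ * t) *
              Real.exp (-(max 0 (ev i).re + δ) * T)) := by ring
          _ ≤ C * ρ * 1 := mul_le_mul_of_nonneg_left h2 (by positivity)
          _ = _ := mul_one _
      have h5 : ‖c (φ t x, φ t y)‖ ≤ C * ρ := (pi_norm_le_iff_of_nonneg (by positivity)).2 h1
      have h6 : ‖(φ t x, φ t y)‖ ≤ N * ‖c (φ t x, φ t y)‖ := by
        have := c.symm.toContinuousLinearMap.le_opNorm (c (φ t x, φ t y))
        simpa using this
      have h7 : (N + 1) * (C * ρ) = r := by rw [hρdef]; field_simp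
      have h8 := mul_le_mul_of_nonneg_left h5 hN0
      have h9 : 0 < C * ρ := by positivity
      linarith
    exact ⟨fun t ht => (le_max_left _ _).trans (key t ht),
      fun t ht => (le_max_right _ _).trans (key t ht)⟩
  have hsq : ENNReal.ofReal (κ * ∏ i, d i) ^ 2 ≤ volume (dynamicalBall φ T r) ^ 2 := by
    rw [← hvol d fun i => by positivity, sq, ← Measure.prod_prod]
    exact measure_mono hsub
  refine (ENNReal.ofReal_le_ofReal ?_).trans
    ((ENNReal.pow_right_strictMono two_ne_zero).le_iff_le.1 hsq)
  rw [prod_const_mul_exp, ← mul_assoc]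
  refine mul_le_mul_of_nonneg_left (Real.exp_le_exp.2 ?_) (by positivity)
  refine mul_le_mul_of_nonneg_right (neg_le_neg ?_) hT
  rw [Finset.sum_add_distrib, ← hsum, Finset.sum_const, Finset.card_univ, nsmul_eq_mul]
  have h4 : (Fintype.card ι + 1) * δ = a - unstableEigenvalueSum A := by
    rw [hδdef]; field_simp
  linarith

theorem isClosed_dynamicalBall {n : ℕ} {A : Matrix (Fin n) (Fin n) ℝ}
    {φ : ℝ → (Fin n → ℝ) → (Fin n → ℝ)} (hφ : IsSolutionMap (fun _ x => A.mulVec x) φ)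
    (T r : ℝ) : IsClosed (dynamicalBall φ T r) := by
  have : dynamicalBall φ T r = ⋂ t ∈ Set.Icc 0 T, {x | ‖φ t x‖ ≤ r} := by
    ext x
    simp [dynamicalBall]
  rw [this]
  refine isClosed_biInter fun t ht => ?_
  obtain ⟨Ψ, hΨ⟩ := exists_clm_flow hφ ht.1
  simp only [hΨ]
  exact isClosed_le Ψ.continuous.norm continuous_const

theorem flow_sub {n : ℕ} {A : Matrix (Fin n) (Fin n) ℝ}
    {φ : ℝ → (Fin n → ℝ) → (Fin n → ℝ)} (hφ : IsSolutionMap (fun _ x => A.mulVec x) φ)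
    {t : ℝ} (ht : 0 ≤ t) (x y : Fin n → ℝ) : φ t (x - y) = φ t x - φ t y := by
  obtain ⟨Ψ, hΨ⟩ := exists_clm_flow hφ ht
  simp only [hΨ, map_sub]

/-! ### Spanning and separated sets -/

theorem le_spanningCard {E : Type*} [NormedAddCommGroup E] {φ : ℝ → E → E} {K : Set E}
    {T ε : ℝ} {x : ENNReal} (h : ∀ S, IsSpanning φ K T ε S → x ≤ (S.card : ENNReal)) :
    x ≤ ((spanningCard φ K T ε : ℕ∞) : ENNReal) := by
  rw [spanningCard, iInf_subtype']
  rcases isEmpty_or_nonempty {S : Finset E // IsSpanning φ K T ε S} with he | he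
  · simp
  · obtain ⟨S, hS⟩ := ENat.exists_eq_iInf
      fun S : {S : Finset E // IsSpanning φ K T ε S} => (S.1.card : ℕ∞)
    rw [← hS]
    simpa using h S.1 S.2

theorem spanningCard_le {E : Type*} [NormedAddCommGroup E] {φ : ℝ → E → E} {K : Set E}
    {T ε : ℝ} {S : Finset E} (hS : IsSpanning φ K T ε S) :
    ((spanningCard φ K T ε : ℕ∞) : ENNReal) ≤ (S.card : ENNReal) := by
  have : spanningCard φ K T ε ≤ (S.card : ℕ∞) := iInf₂_le S hS
  simpa using ENat.toENNReal_le.2 this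

/-- The translates of the dynamical ball about a spanning set cover. -/
theorem volume_le_card_mul_of_isSpanning {n : ℕ} {A : Matrix (Fin n) (Fin n) ℝ}
    {φ : ℝ → (Fin n → ℝ) → (Fin n → ℝ)} (hφ : IsSolutionMap (fun _ x => A.mulVec x) φ)
    {K : Set (Fin n → ℝ)} {T ε : ℝ} {S : Finset (Fin n → ℝ)} (hS : IsSpanning φ K T ε S) :
    volume K ≤ S.card * volume (dynamicalBall φ T ε) := by
  have hsub : K ⊆ ⋃ x ∈ S, (fun y => y + -x) ⁻¹' dynamicalBall φ T ε := by
    intro y hy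
    obtain ⟨x, hx, h⟩ := hS.2 y hy
    refine Set.mem_iUnion₂.2 ⟨x, hx, fun t ht => ?_⟩
    change ‖φ t (y + -x)‖ ≤ ε
    rw [← sub_eq_add_neg, flow_sub hφ ht.1]
    exact (h t ht).le
  calc volume K ≤ ∑ x ∈ S, volume ((fun y => y + -x) ⁻¹' dynamicalBall φ T ε) :=
        (measure_mono hsub).trans (measure_biUnion_finset_le _ _)
    _ = _ := by simp [measure_preimage_add_right]

/-- Points of a separated set are centres of disjoint dynamical balls. -/
theorem card_mul_volume_le_of_separated {n : ℕ} {A : Matrix (Fin n) (Fin n) ℝ}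
    {φ : ℝ → (Fin n → ℝ) → (Fin n → ℝ)} (hφ : IsSolutionMap (fun _ x => A.mulVec x) φ)
    {K : Set (Fin n → ℝ)} {T ε : ℝ} (hT : 0 ≤ T) (hε : 0 < ε) {S : Finset (Fin n → ℝ)}
    (hSK : (S : Set (Fin n → ℝ)) ⊆ K)
    (hsep : ∀ x ∈ S, ∀ y ∈ S, x ≠ y → ∃ t ∈ Set.Icc 0 T, ε ≤ ‖φ t x - φ t y‖) :
    S.card * volume (dynamicalBall φ T (ε / 3)) ≤ volume (Metric.cthickening (ε / 3) K) := by
  -- Radius `ε / 3` rather than `ε / 2`: the balls are closed and the separation is only `ε ≤`, so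
  -- disjointness needs `2ε / 3 < ε`.
  let U : (Fin n → ℝ) → Set (Fin n → ℝ) := fun x =>
    (fun y => y + -x) ⁻¹' dynamicalBall φ T (ε / 3)
  have hU : ∀ x z, z ∈ U x → ∀ t ∈ Set.Icc 0 T, ‖φ t z - φ t x‖ ≤ ε / 3 := by
    intro x z hz t ht
    have : ‖φ t (z + -x)‖ ≤ ε / 3 := hz t ht
    rwa [← sub_eq_add_neg, flow_sub hφ ht.1] at this
  have hdisj : Set.PairwiseDisjoint (S : Set (Fin n → ℝ)) U := by
    intro x hx y hy hxy
    refine Set.disjoint_left.2 fun z hzx hzy => ?_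
    obtain ⟨t, ht, hlt⟩ := hsep x hx y hy hxy
    have h1 := hU x z hzx t ht
    have h2 := hU y z hzy t ht
    have h3 := norm_sub_le (φ t z - φ t y) (φ t z - φ t x)
    rw [sub_sub_sub_cancel_left] at h3
    linarith
  have hmeas : ∀ x ∈ S, MeasurableSet (U x) := fun x _ =>
    ((isClosed_dynamicalBall hφ T (ε / 3)).preimage (by fun_prop)).measurableSet
  calc S.card * volume (dynamicalBall φ T (ε / 3)) = ∑ x ∈ S, volume (U x) := by
        simp [U, measure_preimage_add_right]
    _ = volume (⋃ x ∈ S, U x) := (measure_biUnion_finset hdisj hmeas).symm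
    _ ≤ _ := by
        refine measure_mono (Set.iUnion₂_subset fun x hx z hz => ?_)
        have h := hU x z hz 0 ⟨le_rfl, hT⟩
        rw [(hφ z).1, (hφ x).1, ← dist_eq_norm] at h
        exact Metric.mem_cthickening_of_dist_le z x _ K (hSK hx) h

/-- A separated set of maximal cardinality is spanning. -/
theorem exists_isSpanning_separated {E : Type*} [NormedAddCommGroup E] {φ : ℝ → E → E}
    {K : Set E} {T ε : ℝ} (hε : 0 < ε) {N : ℕ}
    (hN : ∀ S : Finset E, (S : Set E) ⊆ K →
      (∀ x ∈ S, ∀ y ∈ S, x ≠ y → ∃ t ∈ Set.Icc 0 T, ε ≤ ‖φ t x - φ t y‖) → S.card ≤ N) :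
    ∃ S : Finset E, IsSpanning φ K T ε S ∧
      ∀ x ∈ S, ∀ y ∈ S, x ≠ y → ∃ t ∈ Set.Icc 0 T, ε ≤ ‖φ t x - φ t y‖ := by
  classical
  let P : ℕ → Prop := fun m => ∃ S : Finset E, (S : Set E) ⊆ K ∧
    (∀ x ∈ S, ∀ y ∈ S, x ≠ y → ∃ t ∈ Set.Icc 0 T, ε ≤ ‖φ t x - φ t y‖) ∧ S.card = m
  have hP0 : P 0 := ⟨∅, by simp, by simp, rfl⟩
  obtain ⟨S, hSK, hsep, hcard⟩ : P (Nat.findGreatest P N) :=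
    Nat.findGreatest_spec (Nat.zero_le N) hP0
  refine ⟨S, ⟨hSK, fun y hy => ?_⟩, hsep⟩
  by_contra! hcon
  have hyS : y ∉ S := by
    intro hyS
    obtain ⟨t, _, h⟩ := hcon y hyS
    rw [sub_self, norm_zero] at h
    exact absurd h (not_le.2 hε)
  have hsub : ((insert y S : Finset E) : Set E) ⊆ K := by
    rw [Finset.coe_insert]
    exact Set.insert_subset hy hSK
  have hsep' : ∀ x ∈ insert y S, ∀ z ∈ insert y S, x ≠ z →
      ∃ t ∈ Set.Icc 0 T, ε ≤ ‖φ t x - φ t z‖ := by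
    intro x hx z hz hxz
    rcases Finset.mem_insert.1 hx with rfl | hxS <;>
      rcases Finset.mem_insert.1 hz with rfl | hzS
    · exact absurd rfl hxz
    · exact hcon z hzS
    · obtain ⟨t, ht, h⟩ := hcon x hxS
      exact ⟨t, ht, by rwa [norm_sub_rev]⟩
    · exact hsep x hxS z hzS hxz
  have hle := Nat.le_findGreatest (P := P) (hN _ hsub hsep') ⟨_, hsub, hsep', rfl⟩
  rw [Finset.card_insert_of_notMem hyS] at hle
  omega

/-! ### Entropy at a fixed scale -/

theorem tendsto_log_const_mul_exp_div {C : ℝ} (hC : 0 < C) (a : ℝ) :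
    Tendsto (fun T : ℝ => ENNReal.log (ENNReal.ofReal (C * Real.exp (a * T))) / (T : EReal))
      atTop (𝓝 (a : EReal)) := by
  have h1 : Tendsto (fun T : ℝ => Real.log C / T + a) atTop (𝓝 a) := by
    simpa using (tendsto_const_nhds.div_atTop tendsto_id).add_const a
  refine ((continuous_coe_real_ereal.tendsto a).comp h1).congr' ?_
  filter_upwards [eventually_gt_atTop 0] with T hT
  rw [ENNReal.log_ofReal_of_pos (by positivity), ← EReal.coe_div,
    Real.log_mul hC.ne' (Real.exp_pos _).ne', Real.log_exp, Function.comp_apply]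
  congr 1
  field_simp

theorem le_entropyAtScale {n : ℕ} {A : Matrix (Fin n) (Fin n) ℝ}
    {φ : ℝ → (Fin n → ℝ) → (Fin n → ℝ)} (hφ : IsSolutionMap (fun _ x => A.mulVec x) φ)
    {K : Set (Fin n → ℝ)} (hK : IsCompact K) (hKpos : 0 < volume K) {ε a : ℝ} (hε : 0 < ε)
    (ha : a < unstableEigenvalueSum A) : (a : EReal) ≤ entropyAtScale φ K ε := by
  obtain ⟨C, hC, hvol⟩ := volume_dynamicalBall_le hφ hε ha
  set v := (volume K).toReal with hv
  have hv0 : 0 < v := ENNReal.toReal_pos hKpos.ne' hK.measure_lt_top.ne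
  rw [← (tendsto_log_const_mul_exp_div (div_pos hv0 hC) a).limsup_eq]
  refine limsup_le_limsup ?_
  filter_upwards [eventually_gt_atTop 0] with T hT
  refine EReal.div_le_div_right_of_nonneg (EReal.coe_nonneg.2 hT.le) (ENNReal.log_le_log ?_)
  refine le_spanningCard fun S hS => ?_
  have h1 := (volume_le_card_mul_of_isSpanning hφ hS).trans
    (mul_le_mul_of_nonneg_left (hvol T hT.le) zero_le)
  rw [← ENNReal.ofReal_toReal hK.measure_lt_top.ne, ← hv, ← ENNReal.ofReal_natCast,
    ← ENNReal.ofReal_mul (Nat.cast_nonneg _),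
    ENNReal.ofReal_le_ofReal_iff (by positivity)] at h1
  rw [← ENNReal.ofReal_natCast]
  refine ENNReal.ofReal_le_ofReal ?_
  rw [neg_mul, Real.exp_neg] at h1
  calc v / C * Real.exp (a * T)
      ≤ (S.card * (C * (Real.exp (a * T))⁻¹)) / C * Real.exp (a * T) := by gcongr
    _ = S.card := by field_simp

theorem entropyAtScale_le {n : ℕ} {A : Matrix (Fin n) (Fin n) ℝ}
    {φ : ℝ → (Fin n → ℝ) → (Fin n → ℝ)} (hφ : IsSolutionMap (fun _ x => A.mulVec x) φ)
    {K : Set (Fin n → ℝ)} (hK : IsCompact K) {ε a : ℝ} (hε : 0 < ε)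
    (ha : unstableEigenvalueSum A < a) : entropyAtScale φ K ε ≤ (a : EReal) := by
  obtain ⟨C, hC, hvol⟩ := le_volume_dynamicalBall hφ (div_pos hε three_pos) ha
  have hfin : volume (Metric.cthickening (ε / 3) K) ≠ ⊤ := hK.cthickening.measure_lt_top.ne
  set v := (volume (Metric.cthickening (ε / 3) K)).toReal with hv
  have hv0 : 0 ≤ v := ENNReal.toReal_nonneg
  -- `v + 1` replaces `v`, which is only known to be nonnegative, so that the constant under the
  -- logarithm is positive.
  rw [← (tendsto_log_const_mul_exp_div (div_pos (add_pos_of_nonneg_of_pos hv0 one_pos) hC)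
    a).limsup_eq]
  refine limsup_le_limsup ?_
  filter_upwards [eventually_gt_atTop 0] with T hT
  refine EReal.div_le_div_right_of_nonneg (EReal.coe_nonneg.2 hT.le) (ENNReal.log_le_log ?_)
  have hcard : ∀ S : Finset (Fin n → ℝ), (S : Set (Fin n → ℝ)) ⊆ K →
      (∀ x ∈ S, ∀ y ∈ S, x ≠ y → ∃ t ∈ Set.Icc 0 T, ε ≤ ‖φ t x - φ t y‖) →
      (S.card : ℝ) ≤ (v + 1) / C * Real.exp (a * T) := by
    intro S hSK hsep
    have h1 := (mul_le_mul_of_nonneg_left (hvol T hT.le) zero_le).trans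
      (card_mul_volume_le_of_separated hφ hT.le hε hSK hsep)
    rw [← ENNReal.ofReal_toReal hfin, ← hv, ← ENNReal.ofReal_natCast,
      ← ENNReal.ofReal_mul (Nat.cast_nonneg _), ENNReal.ofReal_le_ofReal_iff hv0,
      neg_mul, Real.exp_neg] at h1
    calc (S.card : ℝ) = (S.card * (C * (Real.exp (a * T))⁻¹)) / C * Real.exp (a * T) := by
          field_simp
      _ ≤ (v + 1) / C * Real.exp (a * T) := by
          gcongr
          linarith
  obtain ⟨S, hS, hsep⟩ := exists_isSpanning_separated hε
    fun S hSK hsep => Nat.le_floor (hcard S hSK hsep)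
  refine (spanningCard_le hS).trans ?_
  rw [← ENNReal.ofReal_natCast]
  exact ENNReal.ofReal_le_ofReal (hcard S hS.1 hsep)

theorem mainTheorem5 {n : ℕ} (A : Matrix (Fin n) (Fin n) ℝ)
    (φ : ℝ → (Fin n → ℝ) → (Fin n → ℝ))
    (hφ : IsSolutionMap (fun _ x => A.mulVec x) φ)
    (K : Set (Fin n → ℝ)) (hK : IsCompact K) (hKpos : 0 < volume K) :
    HasTopologicalEntropy φ K ((unstableEigenvalueSum A : ℝ) : EReal) := by
  -- The value at each scale `ε > 0` is already the eigenvalue sum, so the limit is that of a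
  -- constant.
  refine tendsto_const_nhds.congr' ?_
  filter_upwards [self_mem_nhdsWithin] with ε hε
  refine le_antisymm (EReal.ge_of_forall_gt_iff_ge.1 fun a ha => ?_)
    (EReal.le_of_forall_lt_iff_le.1 fun a ha => ?_)
  · exact le_entropyAtScale hφ hK hKpos hε (EReal.coe_lt_coe_iff.1 ha)
  · exact entropyAtScale_le hφ hK hε (EReal.coe_lt_coe_iff.1 ha)
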